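/- Let $m,d\ge 0$ be integers, $\mathbb J=\begin{pmatrix}0&I_m\\-I_m&0\end{pmatrix}$, and let $\mathcal H_0,\dots,\mathcal H_d:\mathbb R^{2m}\to\mathbb R$ be differentiable functions whose Hamiltonian vector fields $V_l=\mathbb J^{-1}\nabla\mathcal H_l$ are $C^1$ and bounded with bounded derivative. They define the rough Hamiltonian system $dY_t=V_0(Y_t)\,dt+\sum_{l=1}^dV_l(Y_t)\,dX^l_t$. Fix $T>0$ and $k>0$. For $h=T/N$, $N\in\mathbb N_+$, let $\xi_1,\dots,\xi_d$ (possibly depending on $h$) be independent standard normal random variables on a probability space, let $A_h=\sqrt{k|\ln h|}$, and let $\Delta_l=\sqrt h\,\max(-A_h,\min(A_h,\xi_l))$ be the truncated increments. Let $z\mapsto Y^h_1(z)$ be the random one-step map on $\mathbb R^{2m}$ of a numerical method with step size $h$. Assume: 1. (Expansion.) There are $C^\infty$ maps $d_\alpha:\mathbb R^{2m}\to\mathbb R^{2m}$, $\alpha=(\alpha_0,\dots,\alpha_d)\in\mathbb N^{d+1}$, $|\alpha|=\alpha_0+\dots+\alpha_d\ge1$, such that $$Y^h_1(z)=z+\sum_{|\alpha|\ge1}d_\alpha(z)\,h^{\alpha_0}\Delta_1^{\alpha_1}\cdots\Delta_d^{\alpha_d}$$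 as an expansion that may be differentiated once in $z$: for every $z$ and every $K\in\mathbb N$ there are constants $C$ and $h_0>0$ such that for all $h=T/N<h_0$, almost surely, $Y^h_1$ is differentiable at $z$, and the difference of $Y^h_1(z)$ and $z+\sum_{1\le|\alpha|\le K}d_\alpha(z)h^{\alpha_0}\Delta_1^{\alpha_1}\cdots\Delta_d^{\alpha_d}$, as well as the difference of their derivatives in $z$, is bounded in norm by $C\,(h+|\Delta_1|+\dots+|\Delta_d|)^{K+1}$. (Convergence of the series is not required.) 2. (Leading coefficients.) Writing $e_l$ for the multi-index with $\alpha_l=1$ and $|\alpha|=1$, one has $d_{e_l}=V_l$ for at least one $l\in\{0,\dots,d\}$ (in particular this holds if $d_{e_l}=V_l$ for every $l$). 3. (Symplecticity.) For every $z$ and all sufficiently small $h=T/N$, almost surely, $\left(\frac{\partial Y^h_1(z)}{\partial z}\right)^{\top}\mathbb J\,\frac{\partial Y^h_1(z)}{\partial z}=\mathbb J$. The associated stochastic modified equation is the formal equation $\dot{\tilde y}=\sum_{|\alpha|\ge1}f_\alpha(\tilde y)\,h^{\alpha_0-1}\Delta_1^{\alpha_1}\cdots\Delta_d^{\alpha_d}$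 with coefficients given recursively by $$f_\alpha=d_\alpha-\sum_{i=2}^{|\alpha|}\frac1{i!}\sum_{(k^1,\dots,k^i)}D_{k^1}\cdots D_{k^{i-1}}f_{k^i},\qquad (D_kg)(y)=g'(y)f_k(y),$$ where the inner sum is over all $k^1,\dots,k^i\in\mathbb N^{d+1}$ with $|k^j|\ge1$ and $k^1+\dots+k^i=\alpha$ (so $f_\alpha=d_\alpha$ if $|\alpha|=1$). Then for every $\alpha$ with $|\alpha|\ge1$ there is a $C^\infty$ function $\mathcal H_\alpha:\mathbb R^{2m}\to\mathbb R$ with $f_\alpha(y)=\mathbb J^{-1}\nabla\mathcal H_\alpha(y)$ for all $y\in\mathbb R^{2m}$. -/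

import Mathlib

open MeasureTheory ProbabilityTheory Filter
open scoped ContDiff Topology

namespace RoughModified

noncomputable section

/-- The phase space `ℝ^{2m}`, a point being `y = (P, Q)`, with its Euclidean norm. -/
abbrev Phase (m : ℕ) : Type := EuclideanSpace ℝ (Fin m ⊕ Fin m)

/-- The standard symplectic matrix `((0, I), (-I, 0))`. -/
def symplecticJ (m : ℕ) : Matrix (Fin m ⊕ Fin m) (Fin m ⊕ Fin m) ℝ :=
  Matrix.fromBlocks 0 1 (-1) 0

/-- The Hamiltonian vector field `J⁻¹ ∇H`. -/
def hamiltonianField {m : ℕ} (H : Phase m → ℝ) (y : Phase m) : Phase m :=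
  Matrix.toEuclideanLin (symplecticJ m)⁻¹ (gradient H y)

/-- The Jacobian matrix `(∂ g_i / ∂ z_j)` of a map of phase space. -/
def jacobian {m : ℕ} (g : Phase m → Phase m) (z : Phase m) :
    Matrix (Fin m ⊕ Fin m) (Fin m ⊕ Fin m) ℝ :=
  Matrix.of fun i j => (fderiv ℝ g z (EuclideanSpace.single j 1)) i

/-- The map `g` is differentiable at `z` and preserves the symplectic structure there. -/
def IsSymplecticAt {m : ℕ} (g : Phase m → Phase m) (z : Phase m) : Prop :=
  DifferentiableAt ℝ g z ∧
    (jacobian g z).transpose * symplecticJ m * jacobian g z = symplecticJ m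

/-- Multi-indices `α = (α₀, …, α_d)`. -/
abbrev MultiIndex (d : ℕ) : Type := Fin (d + 1) → ℕ

/-- `|α| = α₀ + ⋯ + α_d`. -/
def order {d : ℕ} (α : MultiIndex d) : ℕ := ∑ l, α l

/-- The step size `h = T / N`. -/
def stepSize (T : ℝ) (N : ℕ) : ℝ := T / N

/-- The threshold `A_h = √(k |ln h|)`. -/
def threshold (k h : ℝ) : ℝ := Real.sqrt (k * |Real.log h|)

/-- The truncated increment `Δ = ζ √h`, where `ζ` is `x` cut off at the levels `± A_h`. -/
def truncIncrement (k h x : ℝ) : ℝ :=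
  max (-threshold k h) (min (threshold k h) x) * Real.sqrt h

/-- The monomial `h^{α₀} Δ₁^{α₁} ⋯ Δ_d^{α_d}`. -/
def stepMonomial {d : ℕ} (h : ℝ) (Δ : Fin d → ℝ) (α : MultiIndex d) : ℝ :=
  h ^ α 0 * ∏ l : Fin d, Δ l ^ α l.succ

/-- The partial sum `z + ∑_{1 ≤ |α| ≤ K} c_α(z) h^{α₀} Δ₁^{α₁} ⋯ Δ_d^{α_d}`. -/
def partialSum {m d : ℕ} (c : MultiIndex d → Phase m → Phase m) (h : ℝ) (Δ : Fin d → ℝ) (K : ℕ)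
    (z : Phase m) : Phase m :=
  z + ∑ n ∈ Finset.Icc 1 K, ∑ α ∈ Finset.piAntidiag Finset.univ n, stepMonomial h Δ α • c α z

/-- The one-step maps `Y N w` (step size `h = T / N`) have the expansion
`z + ∑_{|α| ≥ 1} c_α(z) h^{α₀} Δ₁^{α₁} ⋯ Δ_d^{α_d}` in powers of `h` and of the truncated
increments `Δ_l` of `ξ N l`. The series need not converge: for all `z` and `K`, almost surely, the
remainder after the terms of order at most `K` and its derivative in `z` are
`O((h + |Δ₁| + ⋯ + |Δ_d|)^{K+1})` as `h → 0`. -/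
def HasStepExpansion {m d : ℕ} {Ω : Type*} [MeasurableSpace Ω] (μ : Measure Ω) (T k : ℝ)
    (ξ : ℕ → Fin d → Ω → ℝ) (Y : ℕ → Ω → Phase m → Phase m)
    (c : MultiIndex d → Phase m → Phase m) : Prop :=
  ∀ (z : Phase m) (K : ℕ), ∃ C : ℝ, ∀ᶠ N : ℕ in atTop, ∀ᵐ w ∂μ,
    let h : ℝ := stepSize T N
    let Δ : Fin d → ℝ := fun l => truncIncrement k h (ξ N l w)
    let S : Phase m → Phase m := partialSum c h Δ K
    DifferentiableAt ℝ (Y N w) z ∧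
      ‖Y N w z - S z‖ ≤ C * (h + ∑ l, |Δ l|) ^ (K + 1) ∧
      ‖fderiv ℝ (Y N w) z - fderiv ℝ S z‖ ≤ C * (h + ∑ l, |Δ l|) ^ (K + 1)

/-- `nestedD [g₁, …, g_i] = D_{g₁} ⋯ D_{g_{i-1}} g_i`, where `(D_f g)(y) = g'(y) f(y)`. -/
def nestedD {m : ℕ} : List (Phase m → Phase m) → Phase m → Phase m
  | [] => 0
  | [g] => g
  | g :: g' :: gs => fun y => fderiv ℝ (nestedD (g' :: gs)) y (g y)

/-- The tuples `(k¹, …, kⁱ)` of multi-indices of positive order with `k¹ + ⋯ + kⁱ = α`. -/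
def splittings {d : ℕ} (i : ℕ) (α : MultiIndex d) : Finset (Fin i → MultiIndex d) :=
  (Fintype.piFinset fun _ : Fin i => Finset.Icc 0 α).filter
    fun k => (∀ j, 1 ≤ order (k j)) ∧ ∑ j, k j = α

theorem mem_splittings {d i : ℕ} {α : MultiIndex d} {k : Fin i → MultiIndex d} :
    k ∈ splittings i α ↔ (∀ j, 1 ≤ order (k j)) ∧ ∑ j, k j = α := by
  simp only [splittings, Finset.mem_filter, Fintype.mem_piFinset, Finset.mem_Icc,
    and_iff_right_iff_imp]
  rintro ⟨-, h⟩ j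
  refine ⟨fun l => Nat.zero_le _, ?_⟩
  rw [← h]
  exact Finset.single_le_sum (f := k) (fun j _ => fun l => Nat.zero_le _) (Finset.mem_univ j)

theorem order_lt_of_mem_splittings {d i : ℕ} (hi : 2 ≤ i) {α : MultiIndex d}
    {k : Fin i → MultiIndex d} (hk : k ∈ splittings i α) (j : Fin i) :
    order (k j) < order α := by
  obtain ⟨h1, h2⟩ := mem_splittings.1 hk
  have hs : order α = ∑ j, order (k j) := by
    simp only [order, ← h2, Finset.sum_apply]
    exact Finset.sum_comm
  rw [hs]
  obtain ⟨j', hj'⟩ : ∃ j' : Fin i, j' ≠ j := by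
    have : Nontrivial (Fin i) := Fin.nontrivial_iff_two_le.2 hi
    exact exists_ne j
  exact Finset.single_lt_sum (f := fun j => order (k j)) hj' (Finset.mem_univ j) (Finset.mem_univ j')
    (h1 j') (fun _ _ _ => Nat.zero_le _)

/-- The coefficients `f_α` of the stochastic modified equation
`ẏ = ∑_{|α| ≥ 1} f_α(y) h^{α₀ - 1} Δ₁^{α₁} ⋯ Δ_d^{α_d}` of a method with expansion coefficients
`c_α`; see `modifiedCoeff_eq`. -/
def modifiedCoeff {m d : ℕ} (c : MultiIndex d → Phase m → Phase m) (α : MultiIndex d) :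
    Phase m → Phase m :=
  c α - ∑ i ∈ (Finset.Icc 2 (order α)).attach, ((Nat.factorial i.1 : ℝ)⁻¹) •
    ∑ k ∈ (splittings i.1 α).attach, nestedD (List.ofFn fun j => modifiedCoeff c (k.1 j))
termination_by order α
decreasing_by exact order_lt_of_mem_splittings (Finset.mem_Icc.1 i.2).1 k.2 j

/-- The recursion `f_α = c_α - ∑_{i=2}^{|α|} 1/i! ∑_{k¹+⋯+kⁱ=α} D_{k¹} ⋯ D_{k^{i-1}} f_{kⁱ}`. -/
theorem modifiedCoeff_eq {m d : ℕ} (c : MultiIndex d → Phase m → Phase m) (α : MultiIndex d) :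
    modifiedCoeff c α = c α - ∑ i ∈ Finset.Icc 2 (order α), ((Nat.factorial i : ℝ)⁻¹) •
      ∑ k ∈ splittings i α, nestedD (List.ofFn fun j => modifiedCoeff c (k j)) := by
  rw [modifiedCoeff]
  congr 1
  rw [← Finset.sum_attach (Finset.Icc 2 (order α))]
  refine Finset.sum_congr rfl fun i _ => ?_
  congr 1
  exact Finset.sum_attach (splittings i.1 α)
    (fun k => nestedD (List.ofFn fun j => modifiedCoeff c (k j)))

end

end RoughModified

/-! The modified equation is the backward error analysis of the method. Let `x` stand for the formal
variables `h, Δ₁, …, Δ_d` and put `f = ∑ f_α x^α` with `f_0 = 0`. The recursion for `f_α` says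
exactly that the expansion of the one-step map is the formal time-one flow `exp(D_f) id`
(`stepCoeff_eq_sum_lieIterate`). Three ingredients give the theorem.

Algebra (`infinitesimal_of_exp_preserves`). Let `P_n(α)` be the coefficient of `t^n x^α` in the
pull-back of the constant form `w` by `exp(t D_f)`. The flow equation reads `(n+1) P_{n+1} = L_f
P_n`, and `P_1(α)` is `L_{f_α} w`. Induct on the degree of `α`. If `P_1` vanishes in all lower
degrees, then so does each `P_n` with `n ≥ 1`; as `f_0 = 0`, every `P_n(α)` with `n ≥ 2` vanishes
too. Since `P_0(α) = 0` for `α ≠ 0`, preservation of `w` at `t = 1` leaves `P_1(α) = 0`.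

Analysis (`formal_preserves`). Almost sure symplecticity must pass to the formal series. The
remainder estimate yields an almost sure inequality that is closed in the Gaussian vector, so it
holds for every value `x ∈ ℝ^d` of that vector, by full support. With `x` fixed and `h` small
nothing is truncated, so `h = s²` and `Δ_l = x_l s`. Comparing powers of `s`, then coefficients of
polynomials in `x`, isolates each multi-index.

Geometry (`exists_hamiltonian`). `L_{f_α} w = 0` says that the one-form `v ↦ w(v, f_α)` is closed,
and the Poincaré lemma provides the Hamiltonian. -/

namespace RoughModified

/-! ### Reindexing of sums over antidiagonals -/

/-- Associativity of iterated sums over antidiagonals. -/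
theorem sum_antidiagonal_fst {A M : Type*} [AddCommMonoid A] [Finset.HasAntidiagonal A]
    [AddCommMonoid M] (F : A → A → A → M) (α : A) :
    ∑ p ∈ Finset.HasAntidiagonal.antidiagonal α, ∑ q ∈ Finset.HasAntidiagonal.antidiagonal p.1, F q.1 q.2 p.2 =
      ∑ p ∈ Finset.HasAntidiagonal.antidiagonal α, ∑ q ∈ Finset.HasAntidiagonal.antidiagonal p.2, F p.1 q.1 q.2 := by
  rw [Finset.sum_sigma', Finset.sum_sigma']
  refine Finset.sum_nbij' (fun x => ⟨(x.2.1, x.2.2 + x.1.2), (x.2.2, x.1.2)⟩)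
    (fun x => ⟨(x.1.1 + x.2.1, x.2.2), (x.1.1, x.2.1)⟩) ?_ ?_ ?_ ?_ ?_
  · rintro ⟨⟨a, b⟩, c, e⟩ h
    simp only [Finset.mem_sigma, Finset.HasAntidiagonal.mem_antidiagonal] at h ⊢
    exact ⟨by rw [← add_assoc, h.2, h.1], trivial⟩
  · rintro ⟨⟨a, b⟩, c, e⟩ h
    simp only [Finset.mem_sigma, Finset.HasAntidiagonal.mem_antidiagonal] at h ⊢
    exact ⟨by rw [add_assoc, h.2, h.1], trivial⟩
  · rintro ⟨⟨a, b⟩, c, e⟩ h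
    simp only [Finset.mem_sigma, Finset.HasAntidiagonal.mem_antidiagonal] at h
    obtain ⟨-, rfl⟩ := h
    rfl
  · rintro ⟨⟨a, b⟩, c, e⟩ h
    simp only [Finset.mem_sigma, Finset.HasAntidiagonal.mem_antidiagonal] at h
    obtain ⟨-, rfl⟩ := h
    rfl
  · intros; rfl

/-- Exchange of the first two indices of an iterated sum over antidiagonals. -/
theorem sum_antidiagonal_left_comm {A M : Type*} [AddCommMonoid A] [Finset.HasAntidiagonal A]
    [AddCommMonoid M] (F : A → A → A → M) (α : A) :
    ∑ p ∈ Finset.HasAntidiagonal.antidiagonal α, ∑ q ∈ Finset.HasAntidiagonal.antidiagonal p.2, F p.1 q.1 q.2 =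
      ∑ p ∈ Finset.HasAntidiagonal.antidiagonal α, ∑ q ∈ Finset.HasAntidiagonal.antidiagonal p.2, F q.1 p.1 q.2 := by
  rw [← sum_antidiagonal_fst, ← sum_antidiagonal_fst (fun a b e => F b a e)]
  refine Finset.sum_congr rfl fun p _ => ?_
  refine Finset.sum_nbij' Prod.swap Prod.swap ?_ ?_ ?_ ?_ ?_
  · rintro ⟨a, b⟩ h
    simpa [add_comm] using h
  · rintro ⟨a, b⟩ h
    simpa [add_comm] using h
  · intros; rfl
  · intros; rfl
  · intros; rfl

/-- If `a` vanishes above the line `i + j = M`, a sum over a square is a sum over a triangle. -/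
theorem sum_range_sum_range_eq_sum_antidiagonal {N : Type*} [AddCommMonoid N] (M : ℕ)
    (a : ℕ → ℕ → N) (ha : ∀ i j, M < i + j → a i j = 0) :
    ∑ i ∈ Finset.range (M + 1), ∑ j ∈ Finset.range (M + 1), a i j =
      ∑ n ∈ Finset.range (M + 1), ∑ p ∈ Finset.HasAntidiagonal.antidiagonal n, a p.1 p.2 := by
  rw [Finset.sum_sigma', Finset.sum_sigma']
  symm
  refine Finset.sum_bij_ne_zero (fun x _ _ => ⟨x.2.1, x.2.2⟩) ?_ ?_ ?_ ?_
  · rintro ⟨n, i, j⟩ h -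
    simp only [Finset.mem_sigma, Finset.mem_range, Finset.HasAntidiagonal.mem_antidiagonal] at h ⊢
    omega
  · rintro ⟨n, i, j⟩ h - ⟨n', i', j'⟩ h' - heq
    simp only [Finset.mem_sigma, Finset.mem_range, Finset.HasAntidiagonal.mem_antidiagonal] at h h'
    simp only [Sigma.mk.injEq, heq_eq_eq] at heq
    obtain ⟨rfl, rfl⟩ := heq
    obtain ⟨-, rfl⟩ := h
    obtain ⟨-, rfl⟩ := h'
    rfl
  · rintro ⟨i, j⟩ - h
    have : ¬ M < i + j := fun h' => h (ha i j h')
    exact ⟨⟨i + j, i, j⟩, by simp; omega, h, rfl⟩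
  · intros; rfl

noncomputable section

/-! ### Formal Lie series and the pull-back of a bilinear form -/

section LieSeries

variable {E : Type*} [NormedAddCommGroup E] [NormedSpace ℝ E]

/-- The derivative of the Lie derivative `D_f g` of a map `g` along a vector field `f`. -/
theorem fderiv_fderiv_apply_field {F : Type*} [NormedAddCommGroup F] [NormedSpace ℝ F]
    {g : E → F} {f : E → E} (hg : ContDiff ℝ ∞ g) (hf : ContDiff ℝ ∞ f) (z u : E) :
    fderiv ℝ (fun y => fderiv ℝ g y (f y)) z u =
      fderiv ℝ (fun y => fderiv ℝ g y u) z (f z) + fderiv ℝ g z (fderiv ℝ f z u) := by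
  have hg' : Differentiable ℝ (fderiv ℝ g) :=
    (hg.fderiv_right (m := 1) (by norm_cast)).differentiable (by norm_num)
  have hf' : Differentiable ℝ f := hf.differentiable (by norm_num)
  rw [fderiv_clm_apply (hg' z) (hf' z), fderiv_clm_apply (hg' z) (differentiableAt_const u)]
  -- Symmetry of the second derivative of `g` lets the derivative along the fixed direction `u` be
  -- taken first.
  have hs : IsSymmSndFDerivAt ℝ g z :=
    (hg.contDiffAt (x := z)).isSymmSndFDerivAt (by simp; norm_cast)
  simp [hs.eq (f z) u, add_comm]

theorem contDiff_fderiv_apply_field {F : Type*} [NormedAddCommGroup F] [NormedSpace ℝ F]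
    {g : E → F} {f : E → E} (hg : ContDiff ℝ ∞ g) (hf : ContDiff ℝ ∞ f) :
    ContDiff ℝ ∞ fun y => fderiv ℝ g y (f y) :=
  (hg.fderiv_right (m := ∞) (by norm_cast)).clm_apply hf

variable {A : Type*} [AddCommMonoid A] [Finset.HasAntidiagonal A] [DecidableEq A]

/-- The coefficient of `x^α` in `D_f^i id`, where `f = ∑ f_a x^a` is a formal vector field. -/
def lieIterate (f : A → E → E) : ℕ → A → E → E
  | 0, α => if α = 0 then id else 0
  | i + 1, α => fun z => ∑ p ∈ Finset.HasAntidiagonal.antidiagonal α, fderiv ℝ (lieIterate f i p.2) z (f p.1 z)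

variable {f : A → E → E}

theorem contDiff_lieIterate (hf : ∀ a, ContDiff ℝ ∞ (f a)) (i : ℕ) (α : A) :
    ContDiff ℝ ∞ (lieIterate f i α) := by
  induction i generalizing α with
  | zero =>
    unfold lieIterate
    split_ifs
    · exact contDiff_id
    · exact contDiff_const
  | succ i ih =>
    exact ContDiff.sum fun p _ => contDiff_fderiv_apply_field (ih p.2) (hf p.1)

theorem fderiv_lieIterate_succ (hf : ∀ a, ContDiff ℝ ∞ (f a)) (i : ℕ) (α : A) (z u : E) :
    fderiv ℝ (lieIterate f (i + 1) α) z u = ∑ p ∈ Finset.HasAntidiagonal.antidiagonal α,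
      (fderiv ℝ (fun y => fderiv ℝ (lieIterate f i p.2) y u) z (f p.1 z) +
        fderiv ℝ (lieIterate f i p.2) z (fderiv ℝ (f p.1) z u)) := by
  have h : ∀ p ∈ Finset.HasAntidiagonal.antidiagonal α, DifferentiableAt ℝ
      (fun y => fderiv ℝ (lieIterate f i p.2) y (f p.1 y)) z := fun p _ =>
    ((contDiff_fderiv_apply_field (contDiff_lieIterate hf i p.2) (hf p.1)).differentiable
      (by norm_num)) z
  change fderiv ℝ (fun z => ∑ p ∈ Finset.HasAntidiagonal.antidiagonal α,
    fderiv ℝ (lieIterate f i p.2) z (f p.1 z)) z u = _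
  rw [fderiv_fun_sum h, sum_apply]
  exact Finset.sum_congr rfl fun p _ =>
    fderiv_fderiv_apply_field (contDiff_lieIterate hf i p.2) (hf p.1) z u

theorem lieIterate_one (α : A) : lieIterate f 1 α = f α := by
  funext z
  change ∑ p ∈ Finset.HasAntidiagonal.antidiagonal α, fderiv ℝ (lieIterate f 0 p.2) z (f p.1 z) = f α z
  rw [Finset.sum_eq_single (α, 0)]
  · simp [lieIterate]
  · rintro ⟨a, b⟩ h hne
    have hb : b ≠ 0 := by
      rintro rfl
      simp only [Finset.HasAntidiagonal.mem_antidiagonal, add_zero] at h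
      exact hne (by rw [h])
    simp [lieIterate, hb]
  · intro h
    simp at h

/-- Each application of `D_f` raises the degree by at least one, because `f` has no term of degree
zero. Hence every formal sum over `i` is finite in each degree. -/
theorem lieIterate_eq_zero (deg : A →+ ℕ) (hf0 : ∀ a, deg a = 0 → f a = 0) (i : ℕ) (α : A)
    (hi : deg α < i) : lieIterate f i α = 0 := by
  induction i generalizing α with
  | zero => omega
  | succ i ih =>
    funext z
    refine Finset.sum_eq_zero fun p hp => ?_
    have hdeg : deg p.1 + deg p.2 = deg α := by
      rw [← map_add, Finset.HasAntidiagonal.mem_antidiagonal.1 hp]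
    by_cases h : deg p.1 = 0
    · simp [hf0 _ h]
    · simp [ih p.2 (by omega)]

variable (w : E →L[ℝ] E →L[ℝ] ℝ)

/-- The coefficient of `x^α` in `w(∂(D_f^i id) u, ∂(D_f^j id) v)`. -/
def liePairing (f : A → E → E) (i j : ℕ) (α : A) (z u v : E) : ℝ :=
  ∑ p ∈ Finset.HasAntidiagonal.antidiagonal α,
    w (fderiv ℝ (lieIterate f i p.1) z u) (fderiv ℝ (lieIterate f j p.2) z v)

theorem contDiff_fderiv_apply_const {F : Type*} [NormedAddCommGroup F] [NormedSpace ℝ F]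
    {g : E → F} (hg : ContDiff ℝ ∞ g) (u : E) : ContDiff ℝ ∞ fun y => fderiv ℝ g y u :=
  (hg.fderiv_right (m := ∞) (by norm_cast)).clm_apply contDiff_const

theorem contDiff_liePairing (hf : ∀ a, ContDiff ℝ ∞ (f a)) (i j : ℕ) (α : A) (u v : E) :
    ContDiff ℝ ∞ fun z => liePairing w f i j α z u v :=
  ContDiff.sum fun p _ =>
    (w.contDiff.comp (contDiff_fderiv_apply_const (contDiff_lieIterate hf i p.1) u)).clm_apply
      (contDiff_fderiv_apply_const (contDiff_lieIterate hf j p.2) v)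

/-- Leibniz rule for the Lie derivative of bilinear forms. -/
theorem liePairing_succ_add (hf : ∀ a, ContDiff ℝ ∞ (f a)) (i j : ℕ) (α : A) (z u v : E) :
    liePairing w f (i + 1) j α z u v + liePairing w f i (j + 1) α z u v =
      ∑ p ∈ Finset.HasAntidiagonal.antidiagonal α,
        (fderiv ℝ (fun y => liePairing w f i j p.2 y u v) z (f p.1 z) +
          liePairing w f i j p.2 z (fderiv ℝ (f p.1) z u) v +
          liePairing w f i j p.2 z u (fderiv ℝ (f p.1) z v)) := by
  have hd : ∀ (i : ℕ) (b : A) (u : E),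
      DifferentiableAt ℝ (fun y => fderiv ℝ (lieIterate f i b) y u) z := fun i b u =>
    (contDiff_fderiv_apply_const (contDiff_lieIterate hf i b) u).differentiable (by norm_num) z
  have key : ∀ (b : A) (x : E), fderiv ℝ (fun y => liePairing w f i j b y u v) z x =
      ∑ q ∈ Finset.HasAntidiagonal.antidiagonal b,
        (w (fderiv ℝ (fun y => fderiv ℝ (lieIterate f i q.1) y u) z x)
            (fderiv ℝ (lieIterate f j q.2) z v) +
          w (fderiv ℝ (lieIterate f i q.1) z u)
            (fderiv ℝ (fun y => fderiv ℝ (lieIterate f j q.2) y v) z x)) := by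
    intro b x
    unfold liePairing
    rw [fderiv_fun_sum, sum_apply]
    · refine Finset.sum_congr rfl fun q _ => ?_
      have := w.hasFDerivAt_of_bilinear (hd i q.1 u).hasFDerivAt (hd j q.2 v).hasFDerivAt
      rw [this.fderiv]
      simp [add_comm]
    · intro q _
      exact (w.hasFDerivAt_of_bilinear (hd i q.1 u).hasFDerivAt
        (hd j q.2 v).hasFDerivAt).differentiableAt
  simp only [key]
  simp only [liePairing, fderiv_lieIterate_succ hf, map_sum, sum_apply]
  -- The index of the field sits in the left factor in one pairing and in the right factor in the
  -- other; both are moved outermost, to match the sum over `p` in the goal.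
  rw [sum_antidiagonal_fst (fun a b e => w (fderiv ℝ (fun y => fderiv ℝ (lieIterate f i b) y u) z
      (f a z) + fderiv ℝ (lieIterate f i b) z (fderiv ℝ (f a) z u))
      (fderiv ℝ (lieIterate f j e) z v)),
    sum_antidiagonal_left_comm (fun a b e => w (fderiv ℝ (lieIterate f i a) z u)
      (fderiv ℝ (fun y => fderiv ℝ (lieIterate f j e) y v) z (f b z) +
        fderiv ℝ (lieIterate f j e) z (fderiv ℝ (f b) z v))),
    ← Finset.sum_add_distrib]
  refine Finset.sum_congr rfl fun p _ => ?_
  rw [← Finset.sum_add_distrib, ← Finset.sum_add_distrib, ← Finset.sum_add_distrib]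
  refine Finset.sum_congr rfl fun q _ => ?_
  simp only [map_add, add_apply]
  ring

/-- The coefficient of `t^n x^α` in the pull-back of `w` by the formal flow `exp(t D_f) id`. -/
def pullbackCoeff (f : A → E → E) (n : ℕ) (α : A) (z u v : E) : ℝ :=
  ∑ p ∈ Finset.HasAntidiagonal.antidiagonal n,
    ((p.1.factorial : ℝ)⁻¹ * (p.2.factorial : ℝ)⁻¹) * liePairing w f p.1 p.2 α z u v

/-- The formal flow equation for the pull-back of `w`. -/
theorem pullbackCoeff_succ (hf : ∀ a, ContDiff ℝ ∞ (f a)) (n : ℕ) (α : A) (z u v : E) :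
    (n + 1) * pullbackCoeff w f (n + 1) α z u v = ∑ p ∈ Finset.HasAntidiagonal.antidiagonal α,
        (fderiv ℝ (fun y => pullbackCoeff w f n p.2 y u v) z (f p.1 z) +
          pullbackCoeff w f n p.2 z (fderiv ℝ (f p.1) z u) v +
          pullbackCoeff w f n p.2 z u (fderiv ℝ (f p.1) z v)) := by
  have hd : ∀ (b : A) (x : E), fderiv ℝ (fun y => pullbackCoeff w f n b y u v) z x =
      ∑ p ∈ Finset.HasAntidiagonal.antidiagonal n, ((p.1.factorial : ℝ)⁻¹ * (p.2.factorial : ℝ)⁻¹) *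
        fderiv ℝ (fun y => liePairing w f p.1 p.2 b y u v) z x := by
    intro b x
    have h := fun p : ℕ × ℕ =>
      (contDiff_liePairing w hf p.1 p.2 b u v).differentiable (by norm_num) z
    unfold pullbackCoeff
    rw [fderiv_fun_sum fun p _ => (h p).const_mul _, sum_apply]
    refine Finset.sum_congr rfl fun p _ => ?_
    rw [fderiv_const_mul (h p)]
    simp
  have hL : (n + 1) * pullbackCoeff w f (n + 1) α z u v =
      ∑ p ∈ Finset.HasAntidiagonal.antidiagonal n, ((p.1.factorial : ℝ)⁻¹ * (p.2.factorial : ℝ)⁻¹) *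
        (liePairing w f (p.1 + 1) p.2 α z u v + liePairing w f p.1 (p.2 + 1) α z u v) := by
    -- The factor `n + 1 = p.1 + p.2` is split; each half cancels into one factorial and, after an
    -- index shift, raises one of the two exponents.
    have h1 : (n + 1) * pullbackCoeff w f (n + 1) α z u v =
        ∑ p ∈ Finset.HasAntidiagonal.antidiagonal (n + 1), (p.1 : ℝ) *
            ((p.1.factorial : ℝ)⁻¹ * (p.2.factorial : ℝ)⁻¹ * liePairing w f p.1 p.2 α z u v) +
        ∑ p ∈ Finset.HasAntidiagonal.antidiagonal (n + 1), (p.2 : ℝ) *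
            ((p.1.factorial : ℝ)⁻¹ * (p.2.factorial : ℝ)⁻¹ * liePairing w f p.1 p.2 α z u v) := by
      rw [← Finset.sum_add_distrib, pullbackCoeff, Finset.mul_sum]
      refine Finset.sum_congr rfl fun p hp => ?_
      have : (p.1 : ℝ) + p.2 = n + 1 := by exact_mod_cast Finset.HasAntidiagonal.mem_antidiagonal.1 hp
      rw [← this]
      ring
    rw [h1, Finset.Nat.sum_antidiagonal_succ, Finset.Nat.sum_antidiagonal_succ']
    simp only [Nat.cast_zero, zero_mul, zero_add]
    rw [← Finset.sum_add_distrib]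
    refine Finset.sum_congr rfl fun p _ => ?_
    simp only [Nat.factorial_succ, Nat.cast_mul, Nat.cast_add, Nat.cast_one]
    field_simp
  rw [hL]
  simp only [hd, liePairing_succ_add w hf]
  simp only [pullbackCoeff, Finset.mul_sum, ← Finset.sum_add_distrib]
  rw [Finset.sum_comm]
  refine Finset.sum_congr rfl fun p _ => Finset.sum_congr rfl fun q _ => ?_
  ring

theorem pullbackCoeff_zero {α : A} (hα : α ≠ 0) (z u v : E) :
    pullbackCoeff w f 0 α z u v = 0 := by
  simp only [pullbackCoeff, Finset.Nat.antidiagonal_zero, Finset.sum_singleton, liePairing]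
  rw [Finset.sum_eq_zero, mul_zero]
  rintro ⟨a, b⟩ h
  by_cases ha : a = 0
  · have hb : b ≠ 0 := by
      rintro rfl
      simp only [Finset.HasAntidiagonal.mem_antidiagonal, add_zero] at h
      exact hα (h.symm.trans ha)
    simp [lieIterate, hb]
  · simp [lieIterate, ha]

theorem fderiv_lieIterate_zero (z u : E) : fderiv ℝ (lieIterate f 0 (0 : A)) z u = u := by
  simp [lieIterate]

theorem liePairing_one_zero (α : A) (z u v : E) :
    liePairing w f 1 0 α z u v = w (fderiv ℝ (f α) z u) v := by
  rw [liePairing, Finset.sum_eq_single (α, 0)]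
  · simp [lieIterate_one, fderiv_lieIterate_zero]
  · rintro ⟨a, b⟩ h hne
    have hb : b ≠ 0 := by
      rintro rfl
      simp only [Finset.HasAntidiagonal.mem_antidiagonal, add_zero] at h
      exact hne (by rw [h])
    simp [lieIterate, hb]
  · intro h
    simp at h

theorem liePairing_zero_one (α : A) (z u v : E) :
    liePairing w f 0 1 α z u v = w u (fderiv ℝ (f α) z v) := by
  rw [liePairing, Finset.sum_eq_single (0, α)]
  · simp [lieIterate_one, fderiv_lieIterate_zero]
  · rintro ⟨a, b⟩ h hne
    have hb : a ≠ 0 := by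
      rintro rfl
      simp only [Finset.HasAntidiagonal.mem_antidiagonal, zero_add] at h
      exact hne (by rw [h])
    simp [lieIterate, hb]
  · intro h
    simp at h

/-- For a constant form the first-order coefficient is the Lie derivative along `f_α`: this is the
quantity to be shown zero. -/
theorem pullbackCoeff_one (α : A) (z u v : E) :
    pullbackCoeff w f 1 α z u v = w (fderiv ℝ (f α) z u) v + w u (fderiv ℝ (f α) z v) := by
  simp [pullbackCoeff, Finset.Nat.antidiagonal_succ, liePairing_one_zero, liePairing_zero_one,
    add_comm]

theorem liePairing_eq_zero (deg : A →+ ℕ) (hf0 : ∀ a, deg a = 0 → f a = 0) (i j : ℕ) (α : A)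
    (hij : deg α < i + j) (z u v : E) : liePairing w f i j α z u v = 0 := by
  refine Finset.sum_eq_zero fun p hp => ?_
  have hdeg : deg p.1 + deg p.2 = deg α := by
    rw [← map_add, Finset.HasAntidiagonal.mem_antidiagonal.1 hp]
  by_cases h : deg p.1 < i
  · simp [lieIterate_eq_zero deg hf0 i p.1 h]
  · simp [lieIterate_eq_zero deg hf0 j p.2 (by omega)]

/-- If the first-order terms `L_{f_β} w` vanish in degrees below `M`, then so do all higher-order
terms of the pull-back of `w` in degrees at most `M`. -/
theorem pullbackCoeff_eq_zero_of_lt (deg : A →+ ℕ) (hf : ∀ a, ContDiff ℝ ∞ (f a))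
    (hf0 : ∀ a, deg a = 0 → f a = 0) (M : ℕ)
    (h1 : ∀ β, deg β < M → ∀ z u v, pullbackCoeff w f 1 β z u v = 0) (n : ℕ) (β : A)
    (hβ : deg β ≤ M) (z u v : E) : pullbackCoeff w f (n + 2) β z u v = 0 := by
  have step : ∀ n, (∀ β, deg β < M → ∀ z u v, pullbackCoeff w f (n + 1) β z u v = 0) →
      ∀ β, deg β ≤ M → ∀ z u v, pullbackCoeff w f (n + 2) β z u v = 0 := by
    intro n ih β hβ z u v
    have h := pullbackCoeff_succ w hf (n + 1) β z u v
    rw [Finset.sum_eq_zero] at h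
    · have : ((n + 1 : ℕ) : ℝ) + 1 ≠ 0 := by positivity
      exact (mul_eq_zero.1 h).resolve_left this
    · intro p hp
      have hdeg : deg p.1 + deg p.2 = deg β := by
        rw [← map_add, Finset.HasAntidiagonal.mem_antidiagonal.1 hp]
      -- Either the field coefficient is zero, or it uses up positive degree. This strict drop is
      -- why vanishing below `M` gives vanishing up to and including `M` one order higher in `t`.
      by_cases h0 : deg p.1 = 0
      · simp [hf0 _ h0, pullbackCoeff, liePairing]
      · have hlt : deg p.2 < M := by omega
        simp [ih p.2 hlt]
  have all : ∀ n, ∀ β, deg β < M → ∀ z u v, pullbackCoeff w f (n + 1) β z u v = 0 := by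
    intro n
    induction n with
    | zero => exact h1
    | succ n ih => exact fun β hβ => step n ih β hβ.le
  exact step n (all n) β hβ z u v

/-- If the formal time-one flow of the formal vector field `f` preserves the bilinear form `w`,
then `L_{f_α} w = 0` for every coefficient `f_α`. -/
theorem infinitesimal_of_exp_preserves (deg : A →+ ℕ) (hdeg : ∀ a, deg a = 0 → a = 0)
    (hf : ∀ a, ContDiff ℝ ∞ (f a)) (hf0 : f 0 = 0) (g : A → E → E)
    (hg : ∀ a n, deg a ≤ n → g a = ∑ i ∈ Finset.range (n + 1),
      ((i.factorial : ℝ)⁻¹) • lieIterate f i a)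
    (hw : ∀ α, α ≠ 0 → ∀ z u v, ∑ p ∈ Finset.HasAntidiagonal.antidiagonal α,
      w (fderiv ℝ (g p.1) z u) (fderiv ℝ (g p.2) z v) = 0) (α : A) (z u v : E) :
    w (fderiv ℝ (f α) z u) v + w u (fderiv ℝ (f α) z v) = 0 := by
  have hf0' : ∀ a, deg a = 0 → f a = 0 := fun a ha => by rw [hdeg a ha, hf0]
  suffices H : ∀ M α, deg α = M → ∀ z u v, pullbackCoeff w f 1 α z u v = 0 by
    rw [← pullbackCoeff_one]
    exact H _ α rfl z u v
  intro M
  induction M using Nat.strong_induction_on with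
  | _ M ih =>
  intro α hα z u v
  by_cases hα0 : α = 0
  · simp [pullbackCoeff_one, hα0, hf0]
  -- The pull-back at `t = 1`: no power of `t` beyond the degree `M` of `α` contributes, so the sum
  -- stops there.
  have hsq : ∑ n ∈ Finset.range (M + 1), pullbackCoeff w f n α z u v = 0 := by
    rw [← hw α hα0 z u v]
    unfold pullbackCoeff
    rw [← sum_range_sum_range_eq_sum_antidiagonal M (fun i j =>
      ((i.factorial : ℝ)⁻¹ * (j.factorial : ℝ)⁻¹) * liePairing w f i j α z u v)]
    · have hd : ∀ a, deg a ≤ M → ∀ x, fderiv ℝ (g a) z x = ∑ i ∈ Finset.range (M + 1),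
          ((i.factorial : ℝ)⁻¹) • fderiv ℝ (lieIterate f i a) z x := by
        intro a ha x
        have h := fun i : ℕ => (contDiff_lieIterate hf i a).differentiable (by norm_num) z
        rw [hg a M ha, fderiv_sum fun i _ => (h i).const_smul _, sum_apply]
        refine Finset.sum_congr rfl fun i _ => ?_
        rw [fderiv_const_smul (h i)]
        simp
      symm
      simp only [liePairing, Finset.mul_sum]
      rw [Finset.sum_congr rfl fun i _ => Finset.sum_comm, Finset.sum_comm]
      refine Finset.sum_congr rfl fun p hp => ?_
      have hdp : deg p.1 + deg p.2 = deg α := by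
        rw [← map_add, Finset.HasAntidiagonal.mem_antidiagonal.1 hp]
      rw [hd p.1 (by omega), hd p.2 (by omega)]
      simp only [map_sum, sum_apply, map_smul,
        smul_apply, smul_eq_mul]
      rw [Finset.sum_comm]
      refine Finset.sum_congr rfl fun i _ => ?_
      rw [Finset.mul_sum]
      refine Finset.sum_congr rfl fun j _ => ?_
      ring
    · intro i j hij
      rw [liePairing_eq_zero w deg hf0' i j α (by omega), mul_zero]
  have hM : M ≠ 0 := fun h => hα0 (hdeg α (hα.trans h))
  obtain ⟨K, rfl⟩ := Nat.exists_eq_succ_of_ne_zero hM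
  -- The terms `n = 0` and `n = 1` are split off; the former is zero since `α ≠ 0`, and all terms
  -- with `n ≥ 2` vanish by the induction hypothesis.
  rw [Finset.sum_range_succ', Finset.sum_range_succ', pullbackCoeff_zero w hα0, add_zero,
    Finset.sum_eq_zero, zero_add] at hsq
  · exact hsq
  · intro n _
    exact pullbackCoeff_eq_zero_of_lt w deg hf hf0' _
      (fun β hβ => ih _ hβ β rfl) n α hα.le z u v

end LieSeries

end

end RoughModified

/-! ### The one-step map as formal flow of the modified equation -/

namespace RoughModified

noncomputable section

instance instHasAntidiagonalMultiIndex (d : ℕ) : Finset.HasAntidiagonal (MultiIndex d) :=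
  Finset.HasAntidiagonal.antidiagonalOfLocallyFinite

/-- The order of multi-indices as an additive homomorphism. -/
def orderHom (d : ℕ) : MultiIndex d →+ ℕ where
  toFun := order
  map_zero' := by simp [order]
  map_add' a b := by simp [order, Finset.sum_add_distrib]

theorem order_add {d : ℕ} (a b : MultiIndex d) : order (a + b) = order a + order b :=
  map_add (orderHom d) a b

theorem eq_zero_of_order_eq_zero {d : ℕ} {a : MultiIndex d} (h : order a = 0) : a = 0 := by
  funext l
  exact (Finset.sum_eq_zero_iff.1 h) l (Finset.mem_univ l)

theorem order_pos_iff {d : ℕ} {a : MultiIndex d} : 1 ≤ order a ↔ a ≠ 0 := by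
  rw [Nat.one_le_iff_ne_zero, not_iff_not]
  exact ⟨eq_zero_of_order_eq_zero, by rintro rfl; exact map_zero (orderHom d)⟩

theorem nestedD_cons {m : ℕ} (g : Phase m → Phase m) {l : List (Phase m → Phase m)}
    (hl : l ≠ []) : nestedD (g :: l) = fun y => fderiv ℝ (nestedD l) y (g y) := by
  cases l with
  | nil => exact absurd rfl hl
  | cons g' gs => rfl

theorem contDiff_nestedD {m : ℕ} (l : List (Phase m → Phase m))
    (hl : ∀ g ∈ l, ContDiff ℝ ∞ g) : ContDiff ℝ ∞ (nestedD l) := by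
  induction l with
  | nil => exact contDiff_const
  | cons g l ih =>
    by_cases h : l = []
    · subst h
      exact hl g (by simp)
    · rw [nestedD_cons g h]
      exact contDiff_fderiv_apply_field (ih fun g' hg' => hl g' (by simp [hg'])) (hl g (by simp))

theorem contDiff_modifiedCoeff {m d : ℕ} {c : MultiIndex d → Phase m → Phase m}
    (hc : ∀ α, 1 ≤ order α → ContDiff ℝ ∞ (c α)) (α : MultiIndex d) (hα : 1 ≤ order α) :
    ContDiff ℝ ∞ (modifiedCoeff c α) := by
  induction hn : order α using Nat.strong_induction_on generalizing α with
  | _ n ih =>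
  rw [modifiedCoeff_eq]
  refine (hc α hα).sub ?_
  have : ∀ i ∈ Finset.Icc 2 (order α), ContDiff ℝ ∞ (((Nat.factorial i : ℝ)⁻¹) •
      ∑ k ∈ splittings i α, nestedD (List.ofFn fun j => modifiedCoeff c (k j))) := by
    intro i hi
    have h2 : ∀ k ∈ splittings i α,
        ContDiff ℝ ∞ (nestedD (List.ofFn fun j => modifiedCoeff c (k j))) := by
      intro k hk
      refine contDiff_nestedD _ fun g hg => ?_
      obtain ⟨j, rfl⟩ := List.mem_ofFn.1 hg
      exact ih _ (hn ▸ order_lt_of_mem_splittings (Finset.mem_Icc.1 hi).1 hk j) _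
        ((mem_splittings.1 hk).1 j) rfl
    have h3 := (ContDiff.sum h2).const_smul ((Nat.factorial i : ℝ)⁻¹)
    convert h3 using 1
    funext z
    simp
  have h3 := ContDiff.sum this
  convert h3 using 1
  funext z
  simp

/-- Peeling off the first entry of a tuple corresponds to the outermost `D_f`; tuples with a zero
entry drop out because `f_0 = 0`. The count starts at one because `nestedD [] = 0`, whereas the
zeroth iterate has the identity as its coefficient at `0`. -/
theorem lieIterate_eq_sum_splittings {m d : ℕ} {f : MultiIndex d → Phase m → Phase m}
    (hf : ∀ a, ContDiff ℝ ∞ (f a)) (hf0 : f 0 = 0) (i : ℕ) (α : MultiIndex d) :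
    lieIterate f (i + 1) α =
      ∑ k ∈ splittings (i + 1) α, nestedD (List.ofFn fun j => f (k j)) := by
  induction i generalizing α with
  | zero =>
    rw [zero_add, lieIterate_one]
    by_cases h : α = 0
    · rw [h, hf0, Finset.sum_eq_zero]
      intro k hk
      obtain ⟨h1, h2⟩ := mem_splittings.1 hk
      rw [Fin.sum_univ_one] at h2
      exact absurd h2 (order_pos_iff.1 (h1 0))
    · rw [Finset.sum_eq_single (fun _ => α)]
      · simp [nestedD]
      · intro k hk hne
        obtain ⟨-, h2⟩ := mem_splittings.1 hk
        rw [Fin.sum_univ_one] at h2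
        refine absurd (funext fun j => ?_) hne
        rw [Subsingleton.elim j 0, h2]
      · intro hn
        refine absurd (mem_splittings.2 ⟨fun _ => order_pos_iff.2 h, by simp⟩) hn
  | succ i ih =>
    funext z
    rw [Finset.sum_apply]
    have hcons : ∀ k : Fin (i + 2) → MultiIndex d, nestedD (List.ofFn fun j => f (k j)) z =
        fderiv ℝ (nestedD (List.ofFn fun j => f (Fin.tail k j))) z (f (k 0) z) := by
      intro k
      rw [List.ofFn_succ, nestedD_cons _ (by simp)]
      rfl
    simp only [hcons]
    change ∑ p ∈ Finset.HasAntidiagonal.antidiagonal α,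
      fderiv ℝ (lieIterate f (i + 1) p.2) z (f p.1 z) = _
    have hsum : ∀ p : MultiIndex d × MultiIndex d,
        fderiv ℝ (lieIterate f (i + 1) p.2) z (f p.1 z) = ∑ k ∈ splittings (i + 1) p.2,
          fderiv ℝ (nestedD (List.ofFn fun j => f (k j))) z (f p.1 z) := by
      intro p
      rw [ih, fderiv_sum, sum_apply]
      intro k _
      exact (contDiff_nestedD _ fun g hg => by
        obtain ⟨j, rfl⟩ := List.mem_ofFn.1 hg
        exact hf (k j)).differentiable (by norm_num) z
    simp only [hsum]
    rw [Finset.sum_sigma']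
    refine Finset.sum_bij_ne_zero (fun x _ _ => Fin.cons x.1.1 x.2) ?_ ?_ ?_ ?_
    · rintro ⟨⟨a, b⟩, k⟩ h hne
      simp only [Finset.mem_sigma, Finset.HasAntidiagonal.mem_antidiagonal, mem_splittings] at h
      obtain ⟨hab, hk1, hk2⟩ := h
      have ha : a ≠ 0 := by
        rintro rfl
        simp [hf0] at hne
      refine mem_splittings.2 ⟨fun j => ?_, ?_⟩
      · refine Fin.cases ?_ (fun j => ?_) j
        · simpa using order_pos_iff.2 ha
        · simpa using hk1 j
      · rw [Fin.sum_univ_succ]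
        simp [hk2, hab]
    · rintro ⟨⟨a, b⟩, k⟩ h - ⟨⟨a', b'⟩, k'⟩ h' - heq
      simp only [Finset.mem_sigma, Finset.HasAntidiagonal.mem_antidiagonal, mem_splittings] at h h'
      obtain ⟨rfl, rfl⟩ := Fin.cons_injective2 heq
      obtain ⟨-, -, rfl⟩ := h
      obtain ⟨-, -, rfl⟩ := h'
      rfl
    · intro k hk hne
      obtain ⟨h1, h2⟩ := mem_splittings.1 hk
      refine ⟨⟨(k 0, ∑ j, Fin.tail k j), Fin.tail k⟩, ?_, ?_, ?_⟩
      · simp only [Finset.mem_sigma, Finset.HasAntidiagonal.mem_antidiagonal, mem_splittings]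
        refine ⟨?_, fun j => h1 _, trivial⟩
        rw [← h2, Fin.sum_univ_succ (fun j => k j)]
        rfl
      · exact hne
      · exact Fin.cons_self_tail k
    · rintro ⟨⟨a, b⟩, k⟩ h hne
      simp

/-- The modified coefficients, with the coefficient of order zero set to zero. -/
def modifiedField {m d : ℕ} (c : MultiIndex d → Phase m → Phase m) (α : MultiIndex d) :
    Phase m → Phase m :=
  if α = 0 then 0 else modifiedCoeff c α

/-- The coefficients of the expansion of a one-step map, the term `z` of order zero included. -/
def stepCoeff {m d : ℕ} (c : MultiIndex d → Phase m → Phase m) (α : MultiIndex d) :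
    Phase m → Phase m :=
  if α = 0 then id else c α

variable {m d : ℕ} {c : MultiIndex d → Phase m → Phase m}

theorem contDiff_modifiedField (hc : ∀ α, 1 ≤ order α → ContDiff ℝ ∞ (c α)) (α : MultiIndex d) :
    ContDiff ℝ ∞ (modifiedField c α) := by
  unfold modifiedField
  split_ifs with h
  · exact contDiff_const
  · exact contDiff_modifiedCoeff hc α (order_pos_iff.2 h)

theorem contDiff_stepCoeff (hc : ∀ α, 1 ≤ order α → ContDiff ℝ ∞ (c α)) (α : MultiIndex d) :
    ContDiff ℝ ∞ (stepCoeff c α) := by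
  unfold stepCoeff
  split_ifs with h
  · exact contDiff_id
  · exact hc α (order_pos_iff.2 h)

/-- The one-step map is the formal time-one flow of the modified equation. -/
theorem stepCoeff_eq_sum_lieIterate (hc : ∀ α, 1 ≤ order α → ContDiff ℝ ∞ (c α))
    (α : MultiIndex d) (n : ℕ) (hn : order α ≤ n) :
    stepCoeff c α = ∑ i ∈ Finset.range (n + 1),
      ((i.factorial : ℝ)⁻¹) • lieIterate (modifiedField c) i α := by
  have hf := contDiff_modifiedField hc
  have hf0 : modifiedField c 0 = 0 := if_pos rfl
  have hdeg : ∀ a, orderHom d a = 0 → modifiedField c a = 0 := fun a ha => by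
    rw [eq_zero_of_order_eq_zero ha, hf0]
  have hz : ∀ i, order α < i → lieIterate (modifiedField c) i α = 0 := fun i hi =>
    lieIterate_eq_zero (orderHom d) hdeg i α hi
  rw [← Finset.sum_subset (Finset.range_subset_range.2 (Nat.succ_le_succ hn))]
  swap
  · intro i _ hi
    rw [hz i (by simpa using hi), smul_zero]
  by_cases h : α = 0
  · have h0 : order α = 0 := by rw [h]; exact map_zero (orderHom d)
    rw [h0]
    simp [stepCoeff, h, lieIterate]
  · obtain ⟨K, hK⟩ := Nat.exists_eq_succ_of_ne_zero
      (Nat.one_le_iff_ne_zero.1 (order_pos_iff.2 h))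
    have hm := modifiedCoeff_eq c α
    have hsum : ∀ i ∈ Finset.Icc 2 (order α), ((Nat.factorial i : ℝ)⁻¹) •
        ∑ k ∈ splittings i α, nestedD (List.ofFn fun j => modifiedCoeff c (k j)) =
        ((Nat.factorial i : ℝ)⁻¹) • lieIterate (modifiedField c) i α := by
      intro i hi
      obtain ⟨i, rfl⟩ : ∃ j, i = j + 1 := ⟨i - 1, by have := (Finset.mem_Icc.1 hi).1; omega⟩
      rw [lieIterate_eq_sum_splittings hf hf0]
      congr 1
      refine Finset.sum_congr rfl fun k hk => ?_
      congr 2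
      funext j
      exact (if_neg (order_pos_iff.1 ((mem_splittings.1 hk).1 j))).symm
    rw [Finset.sum_congr rfl hsum, hK] at hm
    rw [hK, Nat.succ_eq_add_one, Finset.sum_range_succ', Finset.sum_range_succ']
    -- The recursion runs over `i ≥ 2`; the missing terms of the exponential are `f_α` for `i = 1`
    -- and zero for `i = 0`.
    have hI : Finset.Icc 2 K.succ = (Finset.range K).map (addRightEmbedding 2) := by
      rw [Finset.range_eq_Ico, Finset.map_add_right_Ico]
      rfl
    rw [hI, Finset.sum_map] at hm
    simp only [addRightEmbedding_apply] at hm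
    rw [stepCoeff, if_neg h, lieIterate_one, modifiedField, if_neg h, hm]
    simp [lieIterate, h]

end

end RoughModified

/-! ### From almost sure symplecticity to the formal expansion -/

namespace RoughModified

noncomputable section

/-- A polynomial that is `O(s^{K+1})` along a sequence `s → 0+` has no terms of degree `≤ K`. -/
theorem coeff_eq_zero_of_abs_sum_le {s : ℕ → ℝ} (hs : Tendsto s atTop (𝓝[>] 0)) {M K : ℕ}
    {a : ℕ → ℝ} {C : ℝ}
    (h : ∀ᶠ N in atTop, |∑ n ∈ Finset.range M, a n * s N ^ n| ≤ C * s N ^ (K + 1))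
    {n : ℕ} (hnM : n < M) (hnK : n ≤ K) : a n = 0 := by
  induction n using Nat.strong_induction_on with
  | _ n ih =>
  have hs0 : Tendsto s atTop (𝓝 0) := hs.mono_right nhdsWithin_le_nhds
  have hpos : ∀ᶠ N in atTop, 0 < s N := hs.eventually self_mem_nhdsWithin
  -- The polynomial divided by `t^n`, its lower coefficients being zero by induction. Thus `q 0 = a
  -- n`, while `|q (s N)|` is at most `C * s N ^ (K + 1 - n)`, which tends to zero.
  let q : ℝ → ℝ := fun t => ∑ j ∈ Finset.range M, if j < n then 0 else a j * t ^ (j - n)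
  have hq : Continuous q := by
    refine continuous_finsetSum _ fun j _ => ?_
    split_ifs <;> fun_prop
  have hq0 : q 0 = a n := by
    refine (Finset.sum_eq_single n ?_ ?_).trans (by simp)
    · intro j _ hj
      split_ifs with hlt
      · rfl
      · rw [zero_pow (by omega), mul_zero]
    · intro hn
      exact absurd (Finset.mem_range.2 hnM) hn
  have hlim : Tendsto (fun N => |q (s N)|) atTop (𝓝 |a n|) := by
    rw [← hq0]
    exact ((hq.tendsto 0).comp hs0).abs
  have hlim' : Tendsto (fun N => C * s N ^ (K + 1 - n)) atTop (𝓝 0) := by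
    have := (hs0.pow (K + 1 - n)).const_mul C
    rwa [zero_pow (by omega), mul_zero] at this
  have hle : |a n| ≤ 0 := by
    refine le_of_tendsto_of_tendsto hlim hlim' ?_
    filter_upwards [h, hpos] with N hN hsN
    have hfac : ∑ j ∈ Finset.range M, a j * s N ^ j = s N ^ n * q (s N) := by
      rw [Finset.mul_sum]
      refine Finset.sum_congr rfl fun j hj => ?_
      split_ifs with hlt
      · rw [ih j hlt (Finset.mem_range.1 hj) (by omega)]
        simp
      · rw [mul_left_comm, ← pow_add]
        congr 2
        omega
    rw [hfac, abs_mul, abs_of_pos (pow_pos hsN n)] at hN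
    have hp : s N ^ (K + 1) = s N ^ n * s N ^ (K + 1 - n) := by
      rw [← pow_add]
      congr 1
      omega
    rw [hp, mul_left_comm] at hN
    exact le_of_mul_le_mul_left hN (pow_pos hsN n)
  exact abs_nonpos_iff.1 hle

/-- The weight of a multi-index: `h` has weight two, the increments have weight one. -/
def weight {d : ℕ} (α : MultiIndex d) : ℕ := 2 * α 0 + ∑ l : Fin d, α l.succ

theorem weight_le {d : ℕ} (α : MultiIndex d) : weight α ≤ 2 * order α := by
  rw [weight, order, Fin.sum_univ_succ]
  omega

/-- The power of `s` sees only the weight, so multi-indices of equal weight must be separated by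
their dependence on `x`. -/
theorem stepMonomial_scaled {d : ℕ} (s : ℝ) (x : Fin d → ℝ) (α : MultiIndex d) :
    stepMonomial (s ^ 2) (fun l => x l * s) α = (∏ l, x l ^ α l.succ) * s ^ weight α := by
  simp only [stepMonomial, mul_pow, Finset.prod_mul_distrib, Finset.prod_pow_eq_pow_sum, weight,
    pow_add, pow_mul]
  ring

theorem stepMonomial_add {d : ℕ} (h : ℝ) (Δ : Fin d → ℝ) (α β : MultiIndex d) :
    stepMonomial h Δ (α + β) = stepMonomial h Δ α * stepMonomial h Δ β := by
  simp only [stepMonomial, Pi.add_apply, pow_add, Finset.prod_mul_distrib]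
  ring

theorem stepMonomial_zero {d : ℕ} (h : ℝ) (Δ : Fin d → ℝ) : stepMonomial h Δ 0 = 1 := by
  simp [stepMonomial]

/-- Extraction of coefficients: if a polynomial in `h` and the increments is `O(s^{K+1})` for
`h = s²` and increments `x s`, for every fixed `x`, then its terms of weight `≤ K` vanish. -/
theorem sum_coeff_eq_zero_of_abs_sum_le {d : ℕ} {ι : Type*} (I : Finset ι)
    (e : ι → MultiIndex d) (p : ι → ℝ) {s : ℕ → ℝ} (hs : Tendsto s atTop (𝓝[>] 0)) {K : ℕ}
    (h : ∀ x : Fin d → ℝ, ∃ C, ∀ᶠ N in atTop,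
      |∑ i ∈ I, p i * stepMonomial (s N ^ 2) (fun l => x l * s N) (e i)| ≤ C * s N ^ (K + 1))
    (α : MultiIndex d) (hα : weight α ≤ K) : ∑ i ∈ I with e i = α, p i = 0 := by
  classical
  let J := I.filter fun i => weight (e i) = weight α
  have hx : ∀ x : Fin d → ℝ, ∑ i ∈ J, p i * ∏ l, x l ^ e i l.succ = 0 := by
    intro x
    obtain ⟨C, hC⟩ := h x
    let M := I.sup (fun i => weight (e i)) + K + 1
    refine coeff_eq_zero_of_abs_sum_le (a := fun n =>
      ∑ i ∈ I with weight (e i) = n, p i * ∏ l, x l ^ e i l.succ) hs (M := M) (K := K) (C := C)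
      ?_ (n := weight α) (by omega) hα
    filter_upwards [hC] with N hN
    have hmaps : ∀ i ∈ I, weight (e i) ∈ Finset.range M := by
      intro i hi
      have := Finset.le_sup (f := fun i => weight (e i)) hi
      simp only [Finset.mem_range, M]
      omega
    rw [← Finset.sum_fiberwise_of_maps_to hmaps] at hN
    refine (le_of_eq ?_).trans hN
    congr 1
    refine Finset.sum_congr rfl fun n _ => ?_
    rw [Finset.sum_mul]
    refine Finset.sum_congr rfl fun i hi => ?_
    rw [stepMonomial_scaled, (Finset.mem_filter.1 hi).2, mul_assoc]
  -- The exponents of `x` determine all entries of a multi-index but the one at `0`, which the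
  -- weight then recovers.
  let tail : MultiIndex d → (Fin d →₀ ℕ) := fun β => Finsupp.equivFunOnFinite.symm (Fin.tail β)
  have hpoly : ∑ i ∈ J, MvPolynomial.monomial (tail (e i)) (p i) = 0 := by
    refine MvPolynomial.funext fun x => ?_
    rw [map_sum, map_zero, ← hx x]
    refine Finset.sum_congr rfl fun i _ => ?_
    rw [MvPolynomial.eval_monomial, Finsupp.prod_fintype _ _ (by simp)]
    rfl
  have hcoeff := congrArg (MvPolynomial.coeff (tail α)) hpoly
  rw [MvPolynomial.coeff_sum, MvPolynomial.coeff_zero] at hcoeff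
  simp only [MvPolynomial.coeff_monomial] at hcoeff
  rw [← Finset.sum_filter, Finset.filter_filter] at hcoeff
  rw [← hcoeff]
  refine Finset.sum_congr (Finset.filter_congr fun i _ => ⟨?_, ?_⟩) fun _ _ => rfl
  · intro hi
    rw [hi]
    exact ⟨rfl, rfl⟩
  · rintro ⟨hw, ht⟩
    have ht' : Fin.tail (e i) = Fin.tail α := Finsupp.equivFunOnFinite.symm.injective ht
    have hl : ∀ l : Fin d, e i l.succ = α l.succ := fun l => congrFun ht' l
    have h0 : e i 0 = α 0 := by
      simp only [weight, hl] at hw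
      omega
    funext l
    exact Fin.cases h0 hl l

/-- Independent standard normal variables have full support: a closed condition that holds almost
surely holds everywhere. -/
theorem forall_of_ae_gaussian {d : ℕ} {Ω : Type*} [MeasurableSpace Ω] {μ : Measure Ω}
    [IsProbabilityMeasure μ] {ξ : Fin d → Ω → ℝ}
    (hlaw : ∀ l, HasLaw (ξ l) (gaussianReal 0 1) μ) (hind : iIndepFun ξ μ)
    {P : (Fin d → ℝ) → Prop} (hP : IsClosed {x | P x})
    (h : ∀ᵐ η ∂μ, P fun l => ξ l η) (x : Fin d → ℝ) : P x := by
  have hmap := (iIndepFun_iff_map_fun_eq_pi_map fun l => (hlaw l).aemeasurable).1 hind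
  have hlaw' : (fun l => μ.map (ξ l)) = fun _ => gaussianReal 0 1 :=
    funext fun l => (hlaw l).map_eq
  rw [hlaw'] at hmap
  -- Lebesgue measure is absolutely continuous with respect to the Gaussian, so the latter charges
  -- every nonempty open set. So does the product, and a closed set of full measure is everything.
  have : (gaussianReal 0 1).IsOpenPosMeasure :=
    (gaussianReal_absolutelyContinuous' 0 one_ne_zero).isOpenPosMeasure
  have hae : ∀ᵐ y ∂(Measure.pi fun _ : Fin d => gaussianReal 0 1), P y := by
    rw [← hmap]
    exact (ae_map_iff (aemeasurable_pi_lambda _ fun l => (hlaw l).aemeasurable)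
      hP.measurableSet).2 h
  have hd := Measure.dense_of_ae hae
  have := hd.closure_eq
  rw [hP.closure_eq] at this
  exact (Set.eq_univ_iff_forall.1 this) x

theorem tendsto_sqrt_stepSize {T : ℝ} (hT : 0 < T) :
    Tendsto (fun N : ℕ => Real.sqrt (stepSize T N)) atTop (𝓝[>] 0) := by
  refine tendsto_nhdsWithin_iff.2 ⟨?_, ?_⟩
  · have h := (tendsto_const_div_atTop_nhds_zero_nat T).sqrt
    rwa [Real.sqrt_zero] at h
  · filter_upwards [eventually_gt_atTop 0] with N hN
    have : (0 : ℝ) < N := by exact_mod_cast hN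
    exact Real.sqrt_pos.2 (div_pos hT this)

theorem tendsto_threshold {T k : ℝ} (hT : 0 < T) (hk : 0 < k) :
    Tendsto (fun N : ℕ => threshold k (stepSize T N)) atTop atTop := by
  refine Real.tendsto_sqrt_atTop.comp (Tendsto.const_mul_atTop hk ?_)
  refine tendsto_abs_atBot_atTop.comp ?_
  refine Real.tendsto_log_nhdsGT_zero.comp (tendsto_nhdsWithin_iff.2 ⟨?_, ?_⟩)
  · exact tendsto_const_div_atTop_nhds_zero_nat T
  · filter_upwards [eventually_gt_atTop 0] with N hN
    have : (0 : ℝ) < N := by exact_mod_cast hN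
    exact div_pos hT this

/-- For small step sizes, a given number is not truncated. -/
theorem eventually_truncIncrement_eq {T k : ℝ} (hT : 0 < T) (hk : 0 < k) (x : ℝ) :
    ∀ᶠ N : ℕ in atTop,
      truncIncrement k (stepSize T N) x = x * Real.sqrt (stepSize T N) := by
  filter_upwards [(tendsto_threshold hT hk).eventually_ge_atTop |x|] with N hN
  have := abs_le.1 hN
  rw [truncIncrement, min_eq_right this.2, max_eq_right this.1]

theorem continuous_truncIncrement (k h : ℝ) : Continuous (truncIncrement k h) := by
  unfold truncIncrement
  fun_prop

/-- The multi-indices of order at most `K`. -/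
def indicesUpTo (d K : ℕ) : Finset (MultiIndex d) :=
  (Finset.range (K + 1)).biUnion fun n => Finset.piAntidiag Finset.univ n

theorem mem_piAntidiag_univ {d n : ℕ} {α : MultiIndex d} :
    α ∈ Finset.piAntidiag Finset.univ n ↔ order α = n := by
  simp [Finset.mem_piAntidiag, order]

theorem mem_indicesUpTo {d K : ℕ} {α : MultiIndex d} : α ∈ indicesUpTo d K ↔ order α ≤ K := by
  simp only [indicesUpTo, Finset.mem_biUnion, Finset.mem_range, mem_piAntidiag_univ]
  exact ⟨fun ⟨n, hn, h⟩ => by omega, fun h => ⟨_, Nat.lt_succ_of_le h, rfl⟩⟩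

theorem sum_indicesUpTo {d K : ℕ} {M : Type*} [AddCommMonoid M] (F : MultiIndex d → M) :
    ∑ α ∈ indicesUpTo d K, F α =
      F 0 + ∑ n ∈ Finset.Icc 1 K, ∑ α ∈ Finset.piAntidiag Finset.univ n, F α := by
  rw [indicesUpTo, Finset.sum_biUnion]
  · rw [Finset.range_eq_Ico, Finset.sum_eq_sum_Ico_succ_bot (Nat.succ_pos K)]
    congr 1
    simp
  · intro n _ n' _ hne
    refine Finset.disjoint_left.2 fun α h h' => hne ?_
    rw [← mem_piAntidiag_univ.1 h, mem_piAntidiag_univ.1 h']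

variable {m d : ℕ}

/-- The derivative at `z` of the partial sums of the expansion of the one-step map. -/
def partialSumDeriv (c : MultiIndex d → Phase m → Phase m) (K : ℕ) (z : Phase m) (h : ℝ)
    (Δ : Fin d → ℝ) : Phase m →L[ℝ] Phase m :=
  ∑ α ∈ indicesUpTo d K, stepMonomial h Δ α • fderiv ℝ (stepCoeff c α) z

theorem fderiv_partialSum {c : MultiIndex d → Phase m → Phase m}
    (hc : ∀ α, 1 ≤ order α → ContDiff ℝ ∞ (c α)) (K : ℕ) (z : Phase m) (h : ℝ) (Δ : Fin d → ℝ) :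
    fderiv ℝ (partialSum c h Δ K) z = partialSumDeriv c K z h Δ := by
  have heq : partialSum c h Δ K =
      fun z => ∑ α ∈ indicesUpTo d K, stepMonomial h Δ α • stepCoeff c α z := by
    funext z
    rw [sum_indicesUpTo, partialSum, stepMonomial_zero]
    congr 1
    · simp [stepCoeff]
    · refine Finset.sum_congr rfl fun n hn => Finset.sum_congr rfl fun α hα => ?_
      have : α ≠ 0 := order_pos_iff.1 (by
        rw [mem_piAntidiag_univ.1 hα]
        exact (Finset.mem_Icc.1 hn).1)
      rw [stepCoeff, if_neg this]
  have hd : ∀ α, DifferentiableAt ℝ (stepCoeff c α) z := fun α =>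
    (contDiff_stepCoeff hc α).differentiable (by norm_num) z
  rw [heq, fderiv_fun_sum fun α _ => (hd α).fun_const_smul _]
  exact Finset.sum_congr rfl fun α _ => fderiv_fun_const_smul (hd α) _

theorem continuous_partialSumDeriv (c : MultiIndex d → Phase m → Phase m) (K : ℕ) (z : Phase m) :
    Continuous fun q : ℝ × (Fin d → ℝ) => partialSumDeriv c K z q.1 q.2 := by
  unfold partialSumDeriv stepMonomial
  fun_prop

/-- The defect of preservation of a bilinear form, for a perturbation of a map preserving it. -/
theorem abs_bilin_sub_le {E : Type*} [NormedAddCommGroup E] [NormedSpace ℝ E]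
    (w : E →L[ℝ] E →L[ℝ] ℝ) (M L : E →L[ℝ] E) (u v : E) (hM : w (M u) (M v) = w u v) {ε : ℝ}
    (hε : ‖M - L‖ ≤ ε) :
    |w (L u) (L v) - w u v| ≤ ‖w‖ * ‖u‖ * ‖v‖ * (ε * (2 * ‖L‖ + ε)) := by
  have hε0 : 0 ≤ ε := (norm_nonneg _).trans hε
  have hMn : ‖M‖ ≤ ‖L‖ + ε := by
    calc ‖M‖ = ‖L + (M - L)‖ := by congr 1; abel
      _ ≤ ‖L‖ + ‖M - L‖ := norm_add_le _ _
      _ ≤ ‖L‖ + ε := by gcongr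
  -- The two arguments are replaced one at a time, so that each term carries one factor `M - L`.
  have h1 : w (L u) (L v) - w u v = -(w ((M - L) u) (L v)) - w (M u) ((M - L) v) := by
    rw [← hM]
    simp only [sub_apply, map_sub]
    ring
  have h2 : |w ((M - L) u) (L v)| ≤ ‖w‖ * (ε * ‖u‖) * (‖L‖ * ‖v‖) := by
    refine (w.le_opNorm₂ _ _).trans ?_
    gcongr
    · exact (M - L).le_of_opNorm_le hε u
    · exact L.le_opNorm v
  have h3 : |w (M u) ((M - L) v)| ≤ ‖w‖ * ((‖L‖ + ε) * ‖u‖) * (ε * ‖v‖) := by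
    refine (w.le_opNorm₂ _ _).trans ?_
    gcongr
    · exact M.le_of_opNorm_le hMn u
    · exact (M - L).le_of_opNorm_le hε v
  rw [h1]
  calc |-(w ((M - L) u) (L v)) - w (M u) ((M - L) v)|
      ≤ |w ((M - L) u) (L v)| + |w (M u) ((M - L) v)| := by
        rw [← abs_neg (w ((M - L) u) (L v))]
        exact abs_sub _ _
    _ ≤ _ := add_le_add h2 h3
    _ = _ := by ring

/-- The pair `(0, 0)` contributes exactly `w u v`, so the defect is a polynomial in the step
monomials without that term. -/
theorem bilin_partialSumDeriv_sub (w : Phase m →L[ℝ] Phase m →L[ℝ] ℝ)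
    (c : MultiIndex d → Phase m → Phase m) (K : ℕ) (z u v : Phase m) (h : ℝ) (Δ : Fin d → ℝ) :
    w (partialSumDeriv c K z h Δ u) (partialSumDeriv c K z h Δ v) - w u v =
      ∑ p ∈ (indicesUpTo d K ×ˢ indicesUpTo d K).erase (0, 0),
        w (fderiv ℝ (stepCoeff c p.1) z u) (fderiv ℝ (stepCoeff c p.2) z v) *
          stepMonomial h Δ (p.1 + p.2) := by
  have h0 : order (0 : MultiIndex d) ≤ K := by
    rw [show order (0 : MultiIndex d) = 0 from map_zero (orderHom d)]
    exact Nat.zero_le K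
  have hmem : ((0, 0) : MultiIndex d × MultiIndex d) ∈ indicesUpTo d K ×ˢ indicesUpTo d K :=
    Finset.mk_mem_product (mem_indicesUpTo.2 h0) (mem_indicesUpTo.2 h0)
  rw [Finset.sum_erase_eq_sub hmem]
  congr 1
  · rw [Finset.sum_product]
    simp only [partialSumDeriv, sum_apply, map_sum, smul_apply, map_smul, stepMonomial_add,
      smul_eq_mul]
    rw [Finset.sum_comm]
    refine Finset.sum_congr rfl fun a _ => ?_
    rw [Finset.mul_sum]
    refine Finset.sum_congr rfl fun b _ => ?_
    ring
  · simp [stepCoeff, stepMonomial_zero]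

/-- If the one-step maps preserve `w`, then so does their formal expansion. -/
theorem formal_preserves {Ω : Type*} [MeasurableSpace Ω] {μ : Measure Ω}
    [IsProbabilityMeasure μ] {T k : ℝ} (hT : 0 < T) (hk : 0 < k) {ξ : ℕ → Fin d → Ω → ℝ}
    (hξ_law : ∀ N l, HasLaw (ξ N l) (gaussianReal 0 1) μ) (hξ_indep : ∀ N, iIndepFun (ξ N) μ)
    {Y : ℕ → Ω → Phase m → Phase m} {c : MultiIndex d → Phase m → Phase m}
    (hc : ∀ α, 1 ≤ order α → ContDiff ℝ ∞ (c α)) (hexp : HasStepExpansion μ T k ξ Y c)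
    (w : Phase m →L[ℝ] Phase m →L[ℝ] ℝ) (z u v : Phase m)
    (hw : ∀ᶠ N : ℕ in atTop, ∀ᵐ η ∂μ,
      w (fderiv ℝ (Y N η) z u) (fderiv ℝ (Y N η) z v) = w u v)
    (α : MultiIndex d) (hα : α ≠ 0) :
    ∑ p ∈ Finset.HasAntidiagonal.antidiagonal α,
      w (fderiv ℝ (stepCoeff c p.1) z u) (fderiv ℝ (stepCoeff c p.2) z v) = 0 := by
  classical
  -- Large enough that the weight of `α` is at most `K` and every pair summing to `α` occurs in the
  -- truncated expansion.
  let K := 2 * order α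
  obtain ⟨C, hC⟩ := hexp z K
  let L := partialSumDeriv c K z
  -- A bound in which `Y` no longer appears: it is continuous in the increments, so the resulting
  -- inequality is a closed condition on the Gaussian vector.
  let B : ℝ → (Fin d → ℝ) → ℝ := fun h Δ => ‖w‖ * ‖u‖ * ‖v‖ *
    (C * (h + ∑ l, |Δ l|) ^ (K + 1) * (2 * ‖L h Δ‖ + C * (h + ∑ l, |Δ l|) ^ (K + 1)))
  have hall : ∀ᶠ N : ℕ in atTop, ∀ x : Fin d → ℝ,
      |w (L (stepSize T N) (fun l => truncIncrement k (stepSize T N) (x l)) u)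
          (L (stepSize T N) (fun l => truncIncrement k (stepSize T N) (x l)) v) - w u v| ≤
        B (stepSize T N) (fun l => truncIncrement k (stepSize T N) (x l)) := by
    filter_upwards [hC, hw] with N hCN hwN
    refine forall_of_ae_gaussian (hξ_law N) (hξ_indep N) ?_ ?_
    · have htr := continuous_truncIncrement k (stepSize T N)
      have hLc : Continuous fun x : Fin d → ℝ =>
          L (stepSize T N) (fun l => truncIncrement k (stepSize T N) (x l)) :=
        (continuous_partialSumDeriv c K z).comp
          (continuous_const.prodMk (continuous_pi fun l => htr.comp (continuous_apply l)))
      have hΔ : ∀ l : Fin d, Continuous fun x : Fin d → ℝ =>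
          truncIncrement k (stepSize T N) (x l) := fun l => htr.comp (continuous_apply l)
      refine isClosed_le ?_ ?_
      · exact (((w.continuous.comp (hLc.clm_apply continuous_const)).clm_apply
          (hLc.clm_apply continuous_const)).sub continuous_const).abs
      · have hr : Continuous fun x : Fin d → ℝ => C * (stepSize T N +
            ∑ l, |truncIncrement k (stepSize T N) (x l)|) ^ (K + 1) :=
          continuous_const.mul ((continuous_const.add
            (continuous_finsetSum _ fun l _ => (hΔ l).abs)).pow _)
        exact continuous_const.mul (hr.mul ((continuous_const.mul hLc.norm).add hr))
    · filter_upwards [hCN, hwN] with η h1 h2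
      refine abs_bilin_sub_le w _ _ u v h2 ?_
      change ‖_ - partialSumDeriv c K z _ _‖ ≤ _
      rw [← fderiv_partialSum hc]
      exact h1.2.2
  have hs := tendsto_sqrt_stepSize hT
  have hs0 : Tendsto (fun N : ℕ => Real.sqrt (stepSize T N)) atTop (𝓝 0) :=
    hs.mono_right nhdsWithin_le_nhds
  have hpos : ∀ᶠ N : ℕ in atTop, 0 < Real.sqrt (stepSize T N) :=
    hs.eventually self_mem_nhdsWithin
  have key := sum_coeff_eq_zero_of_abs_sum_le
    ((indicesUpTo d K ×ˢ indicesUpTo d K).erase (0, 0)) (fun p => p.1 + p.2)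
    (fun p => w (fderiv ℝ (stepCoeff c p.1) z u) (fderiv ℝ (stepCoeff c p.2) z v)) hs (K := K)
    ?_ α (weight_le α)
  · rw [← key]
    refine Finset.sum_congr ?_ fun _ _ => rfl
    ext p
    simp only [Finset.HasAntidiagonal.mem_antidiagonal, Finset.mem_filter, Finset.mem_erase,
      Finset.mem_product, mem_indicesUpTo]
    constructor
    · intro hp
      have := order_add p.1 p.2
      rw [hp] at this
      refine ⟨⟨?_, by omega, by omega⟩, hp⟩
      rintro rfl
      exact hα (hp.symm.trans (add_zero 0))
    · exact fun hp => hp.2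
  · intro x
    -- For `0 < s ≤ 1` this gives `s² + ∑ |x_l s| ≤ R s`; `L0` below bounds the norm of the
    -- truncated derivative near `s = 0`.
    let R : ℝ := 1 + ∑ l, |x l|
    have hR : 0 ≤ R := by positivity
    let L0 : ℝ := ‖L 0 0‖ + 1
    have hLlim : ∀ᶠ N : ℕ in atTop, ‖L (Real.sqrt (stepSize T N) ^ 2)
        (fun l => x l * Real.sqrt (stepSize T N))‖ ≤ L0 := by
      have hcont : Continuous fun s : ℝ => ‖L (s ^ 2) (fun l => x l * s)‖ :=
        ((continuous_partialSumDeriv c K z).comp ((continuous_pow 2).prodMk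
          (continuous_pi fun l => continuous_const.mul continuous_id))).norm
      have h1 := (hcont.tendsto 0).comp hs0
      have h2 : ‖L ((0 : ℝ) ^ 2) (fun l => x l * (0 : ℝ))‖ < L0 := by
        have : (fun l => x l * (0 : ℝ)) = 0 := by
          funext l
          simp
        rw [this, zero_pow two_ne_zero]
        exact lt_add_one _
      exact (h1.eventually_lt_const h2).mono fun _ h => h.le
    refine ⟨‖w‖ * ‖u‖ * ‖v‖ * (|C| * R ^ (K + 1) * (2 * L0 + |C| * R ^ (K + 1))), ?_⟩
    have htr : ∀ᶠ N : ℕ in atTop, ∀ l : Fin d, truncIncrement k (stepSize T N) (x l) =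
        x l * Real.sqrt (stepSize T N) :=
      eventually_all.2 fun l => eventually_truncIncrement_eq hT hk (x l)
    filter_upwards [hall, htr, hLlim, hpos, hs0.eventually_le_const one_pos] with
      N hN htrN hLN hsN hs1
    have hsq : stepSize T N = Real.sqrt (stepSize T N) ^ 2 :=
      (Real.sq_sqrt (Real.sqrt_pos.1 hsN).le).symm
    have hNx := hN x
    simp only [htrN] at hNx
    generalize Real.sqrt (stepSize T N) = s at *
    rw [hsq] at hNx
    rw [← bilin_partialSumDeriv_sub]
    refine hNx.trans ?_
    simp only [B]
    have hr : s ^ 2 + ∑ l, |x l * s| ≤ R * s := by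
      simp only [abs_mul, abs_of_pos hsN, ← Finset.sum_mul, R]
      nlinarith
    have hr0 : 0 ≤ s ^ 2 + ∑ l, |x l * s| := by positivity
    have hpow : (s ^ 2 + ∑ l, |x l * s|) ^ (K + 1) ≤ R ^ (K + 1) * s ^ (K + 1) := by
      rw [← mul_pow]
      exact pow_le_pow_left₀ hr0 hr _
    have hs1' : s ^ (K + 1) ≤ 1 := pow_le_one₀ hsN.le hs1
    have hε0 : |C * (s ^ 2 + ∑ l, |x l * s|) ^ (K + 1)| ≤ |C| * R ^ (K + 1) * s ^ (K + 1) := by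
      rw [abs_mul, abs_of_nonneg (pow_nonneg hr0 (K + 1)), mul_assoc]
      exact mul_le_mul_of_nonneg_left hpow (abs_nonneg C)
    have hε1 : |C| * R ^ (K + 1) * s ^ (K + 1) ≤ |C| * R ^ (K + 1) :=
      mul_le_of_le_one_right (by positivity) hs1'
    generalize C * (s ^ 2 + ∑ l, |x l * s|) ^ (K + 1) = ε at *
    -- One factor `ε` keeps the power `s^(K+1)`; the other is bounded by a constant. Absolute values
    -- are taken because the sign of `C` is unknown.
    calc ‖w‖ * ‖u‖ * ‖v‖ * (ε * (2 * ‖L (s ^ 2) fun l => x l * s‖ + ε))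
        ≤ ‖w‖ * ‖u‖ * ‖v‖ * (|C| * R ^ (K + 1) * s ^ (K + 1) *
            (2 * L0 + |C| * R ^ (K + 1))) := by
          refine mul_le_mul_of_nonneg_left ?_ (by positivity)
          refine (le_abs_self _).trans ?_
          rw [abs_mul]
          refine mul_le_mul hε0 ?_ (abs_nonneg _) (by positivity)
          refine (abs_add_le _ _).trans ?_
          rw [abs_of_nonneg (by positivity)]
          exact add_le_add (by linarith) (hε0.trans hε1)
      _ = _ := by ring

end

end RoughModified

/-! ### The symplectic form and the Poincaré lemma -/

namespace RoughModified

noncomputable section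

variable {m : ℕ}

/-- The standard symplectic matrix as a continuous linear map. -/
def symplecticMap (m : ℕ) : Phase m →L[ℝ] Phase m :=
  (Matrix.toEuclideanLin (symplecticJ m)).toContinuousLinearMap

/-- The standard symplectic form `(u, v) ↦ uᵀ J v`. -/
def symplecticForm (m : ℕ) : Phase m →L[ℝ] Phase m →L[ℝ] ℝ :=
  (innerSL ℝ).flip.comp (symplecticMap m) |>.flip

theorem symplecticForm_apply (u v : Phase m) :
    symplecticForm m u v = inner ℝ u (symplecticMap m v) := rfl

theorem symplecticJ_mul_neg (m : ℕ) : symplecticJ m * -symplecticJ m = 1 := by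
  simp [symplecticJ, Matrix.fromBlocks_neg, Matrix.fromBlocks_multiply, Matrix.fromBlocks_one]

theorem symplecticJ_transpose (m : ℕ) : (symplecticJ m).transpose = -symplecticJ m := by
  simp [symplecticJ, Matrix.fromBlocks_neg, Matrix.fromBlocks_transpose]

theorem symplecticJ_inv_mul (m : ℕ) : (symplecticJ m)⁻¹ * symplecticJ m = 1 := by
  rw [Matrix.inv_eq_right_inv (symplecticJ_mul_neg m), neg_mul, ← mul_neg, symplecticJ_mul_neg]

theorem symplecticForm_eq_dotProduct (u v : Phase m) :
    symplecticForm m u v = u.ofLp ⬝ᵥ (symplecticJ m).mulVec v.ofLp := by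
  simp [symplecticForm_apply, symplecticMap, EuclideanSpace.inner_eq_star_dotProduct,
    dotProduct_comm]

theorem symplecticForm_swap (u v : Phase m) : symplecticForm m v u = -symplecticForm m u v := by
  rw [symplecticForm_eq_dotProduct, symplecticForm_eq_dotProduct, Matrix.dotProduct_mulVec,
    ← Matrix.mulVec_transpose, symplecticJ_transpose, Matrix.neg_mulVec, neg_dotProduct,
    dotProduct_comm]

/-- The passage from the matrix identity for the Jacobian to the invariance of the bilinear form. -/
theorem fderiv_eq_jacobian_mulVec (g : Phase m → Phase m) (z u : Phase m) :
    (fderiv ℝ g z u).ofLp = (jacobian g z).mulVec u.ofLp := by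
  funext i
  have hu : u = ∑ j, u j • EuclideanSpace.single j (1 : ℝ) := by
    simpa using ((EuclideanSpace.basisFun (Fin m ⊕ Fin m) ℝ).sum_repr u).symm
  conv_lhs => rw [hu]
  simp [jacobian, Matrix.mulVec, dotProduct, mul_comm]

theorem IsSymplecticAt.symplecticForm_eq {g : Phase m → Phase m} {z : Phase m}
    (h : IsSymplecticAt g z) (u v : Phase m) :
    symplecticForm m (fderiv ℝ g z u) (fderiv ℝ g z v) = symplecticForm m u v := by
  rw [symplecticForm_eq_dotProduct, symplecticForm_eq_dotProduct, fderiv_eq_jacobian_mulVec,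
    fderiv_eq_jacobian_mulVec]
  conv_rhs => rw [← h.2]
  rw [Matrix.mulVec_mulVec, Matrix.dotProduct_mulVec, Matrix.vecMul_mulVec,
    ← Matrix.dotProduct_mulVec, Matrix.mul_assoc]

/-- A vector field whose derivative is infinitesimally symplectic is Hamiltonian. -/
theorem exists_hamiltonian {g : Phase m → Phase m} (hg : ContDiff ℝ ∞ g)
    (h : ∀ z u v, symplecticForm m (fderiv ℝ g z u) v +
      symplecticForm m u (fderiv ℝ g z v) = 0) :
    ∃ H : Phase m → ℝ, ContDiff ℝ ∞ H ∧ ∀ y, g y = hamiltonianField H y := by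
  -- `A (g y)` is the one-form `v ↦ ⟨v, J g(y)⟩`. By skewness of the form, the hypothesis says that
  -- its derivative is symmetric, so it has a primitive `H` on the whole space, with `∇H = J g`.
  let A : Phase m →L[ℝ] (Phase m →L[ℝ] ℝ) := (symplecticForm m).flip
  have hA : ∀ u v, A u v = symplecticForm m v u := fun _ _ => rfl
  have hθ : ContDiff ℝ ∞ fun y => A (g y) := A.contDiff.comp hg
  have hderiv : ∀ z, fderiv ℝ (fun y => A (g y)) z = A.comp (fderiv ℝ g z) := fun z =>
    (A.hasFDerivAt.comp z (hg.differentiable (by norm_num) z).hasFDerivAt).fderiv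
  obtain ⟨H, hH⟩ := convex_univ.exists_forall_hasFDerivAt_of_fderiv_symmetric isOpen_univ
    (hθ.differentiable (by norm_num)).differentiableOn (by
      intro z _ u v
      rw [hderiv]
      simp only [ContinuousLinearMap.comp_apply, hA]
      have h1 := h z u v
      rw [symplecticForm_swap v] at h1
      linarith)
  have hH' : ∀ y, HasFDerivAt H (A (g y)) y := fun y => hH y (Set.mem_univ y)
  refine ⟨H, contDiff_infty_iff_fderiv.2 ⟨fun y => (hH' y).differentiableAt, ?_⟩, fun y => ?_⟩
  · rwa [show fderiv ℝ H = fun y => A (g y) from funext fun y => (hH' y).fderiv]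
  · have hgrad : gradient H y = symplecticMap m (g y) := by
      refine HasGradientAt.gradient (hasGradientAt_iff_hasFDerivAt.2 ?_)
      refine (hH' y).congr_fderiv (ContinuousLinearMap.ext fun v => ?_)
      rw [hA, symplecticForm_apply, InnerProductSpace.toDual_apply_apply, real_inner_comm]
    rw [hamiltonianField, hgrad]
    ext i
    simp [symplecticMap, Matrix.mulVec_mulVec, symplecticJ_inv_mul]

end

end RoughModified

theorem theorem3p1 {m d : ℕ} {Ω : Type*} [MeasurableSpace Ω] (μ : Measure Ω)
    [IsProbabilityMeasure μ]
    (H : Fin (d + 1) → RoughModified.Phase m → ℝ)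
    (V : Fin (d + 1) → RoughModified.Phase m → RoughModified.Phase m)
    (hH : ∀ l, Differentiable ℝ (H l))
    (hV : ∀ l, V l = RoughModified.hamiltonianField (H l))
    (hV_diff : ∀ l, ContDiff ℝ 1 (V l))
    (hV_bdd : ∀ l, ∃ C : ℝ, ∀ y, ‖V l y‖ ≤ C)
    (hV_bdd' : ∀ l, ∃ C : ℝ, ∀ y, ‖fderiv ℝ (V l) y‖ ≤ C)
    (T : ℝ) (hT : 0 < T) (k : ℝ) (hk : 0 < k)
    (ξ : ℕ → Fin d → Ω → ℝ)
    (hξ_law : ∀ N l, HasLaw (ξ N l) (gaussianReal 0 1) μ)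
    (hξ_indep : ∀ N, iIndepFun (ξ N) μ)
    (Y : ℕ → Ω → RoughModified.Phase m → RoughModified.Phase m)
    (c : RoughModified.MultiIndex d → RoughModified.Phase m → RoughModified.Phase m)
    (hc : ∀ α, 1 ≤ RoughModified.order α → ContDiff ℝ ∞ (c α))
    (h_expansion : RoughModified.HasStepExpansion μ T k ξ Y c)
    (h_leading : ∃ l : Fin (d + 1), c (Pi.single l 1) = V l)
    (h_symplectic : ∀ z, ∀ᶠ N : ℕ in atTop, ∀ᵐ w ∂μ, RoughModified.IsSymplecticAt (Y N w) z) :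
    ∀ α, 1 ≤ RoughModified.order α →
      ∃ Hα : RoughModified.Phase m → ℝ, ContDiff ℝ ∞ Hα ∧
        ∀ y, RoughModified.modifiedCoeff c α y = RoughModified.hamiltonianField Hα y := by
  intro α hα
  refine RoughModified.exists_hamiltonian (RoughModified.contDiff_modifiedCoeff hc α hα) ?_
  have h := RoughModified.infinitesimal_of_exp_preserves (RoughModified.symplecticForm m)
    (RoughModified.orderHom d) (fun _ => RoughModified.eq_zero_of_order_eq_zero)
    (RoughModified.contDiff_modifiedField hc) (if_pos rfl) (RoughModified.stepCoeff c)
    (RoughModified.stepCoeff_eq_sum_lieIterate hc)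
    (fun β hβ z u v => RoughModified.formal_preserves hT hk hξ_law hξ_indep hc h_expansion
      (RoughModified.symplecticForm m) z u v
      ((h_symplectic z).mono fun N hN => hN.mono fun η hη => hη.symplecticForm_eq u v) β hβ) α
  -- The normalisation at order zero does not affect `α`, which has positive order.
  rwa [show RoughModified.modifiedField c α = RoughModified.modifiedCoeff c α from
    if_neg (RoughModified.order_pos_iff.1 hα)] at h
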